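/- For $1<p<\infty$ let $A^p$ be the Bergman space of functions $F$ analytic in the open unit disc $\mathbb{D}$ with $\|F\|_{A^p}=\left(\int_{\mathbb{D}}|F|^p\,d\sigma\right)^{1/p}<\infty$, where $\sigma$ is area measure normalized by $\sigma(\mathbb{D})=1$. For an exponent $\alpha\in\mathbb{R}$ and a polynomial $f$ with $f\not\equiv 0$, a branch of $f^{\alpha}$ in $\mathbb{D}$ means a function analytic in all of $\mathbb{D}$ that near each point of $\mathbb{D}$ which is not a zero of $f$ has the form $e^{\alpha L}$ with $L$ analytic and $e^{L}=f$. Let $1<p<\infty$, $N\ge 0$, and let $c_0,\ldots,c_N$ be complex numbers with $c_0\neq 0$. Let $a_0$ be a value of $c_0^{p/2}$, i.e. $a_0=e^{(p/2)\ell}$ for some $\ell$ with $e^{\ell}=c_0$. Put $h(z)=\sum_{j=0}^N \frac{c_j}{j!}z^j$, and let $\beta_j^{p/2}(a_0;c_0,\ldots,c_j)$ be the $j$-th derivative at $0$ of the branch of $h^{p/2}$ near $0$ whose value at $0$ is $a_0$. Define $$f(z)=\sum_{j=0}^N\frac{\beta_j^{p/2}(a_0;c_0,\ldots,c_j)}{j!}z^j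 .$$ Suppose that $f^{1-(2/p)}$ (some, equivalently any, branch of it in $\mathbb{D}$) exists and belongs to $A^{p_1}$ for some $p_1>1$. Suppose also that either (i) $f$ has no zeros in $\mathbb{D}$, or (ii) $p$ is rational, $2/p=r/s$ in lowest terms, and every zero of $f$ in $\mathbb{D}$ has order a multiple of $s$. Then there is a branch of $f^{2/p}$, analytic in $\mathbb{D}$, with $f^{2/p}(0)=c_0$, and it is the unique solution of the minimal interpolation problem: a function $F$ satisfies $F\in A^p$, $F^{(j)}(0)=c_j$ for $0\le j\le N$, and $$\|F\|_{A^p}=\inf\{\|g\|_{A^p} : g\in A^p,\ g(0)=c_0,\ldots,g^{(N)}(0)=c_N\}$$ if and only if $F=f^{2/p}$ in $\mathbb{D}$. -/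

import Mathlib

open MeasureTheory Metric Set Filter Topology

namespace BergmanExtremal

/-- Normalized area measure on the unit disc, so that the disc has measure one. -/
noncomputable def discMeasure : Measure ℂ :=
  (volume (ball (0 : ℂ) 1))⁻¹ • volume.restrict (ball (0 : ℂ) 1)

/-- `F` belongs to the Bergman space `A^p`: it is analytic in the open unit disc and
`|F|^p` is integrable there. Values of `F` off the disc play no role. -/
def MemBergman (p : ℝ) (F : ℂ → ℂ) : Prop :=
  DifferentiableOn ℂ F (ball 0 1) ∧ MemLp F (ENNReal.ofReal p) discMeasure

/-- The norm of `A^p`, that is `(∫ |F|^p dσ)^(1/p)`. -/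
noncomputable def bergmanNorm (p : ℝ) (F : ℂ → ℂ) : ℝ :=
  (eLpNorm F (ENNReal.ofReal p) discMeasure).toReal

/-- The functions `g` in `A^p` with `g^(j)(0) = c_j` for `0 ≤ j ≤ N`. -/
def interpolants (p : ℝ) {N : ℕ} (c : Fin (N + 1) → ℂ) : Set (ℂ → ℂ) :=
  {g | MemBergman p g ∧ ∀ j : Fin (N + 1), iteratedDeriv j g 0 = c j}

/-- `F` solves the minimal interpolation problem in `A^p` with data `c`. -/
def IsMinimalInterpolant (p : ℝ) {N : ℕ} (c : Fin (N + 1) → ℂ) (F : ℂ → ℂ) : Prop :=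
  F ∈ interpolants p c ∧ bergmanNorm p F = sInf (bergmanNorm p '' interpolants p c)

/-- `a` is the value at `w` of some branch of `z ^ α` near the point `w` (hence `w ≠ 0`). -/
def IsPowValue (α : ℝ) (w a : ℂ) : Prop :=
  ∃ l : ℂ, Complex.exp l = w ∧ a = Complex.exp (α * l)

/-- `G` is a branch of `f ^ α` on the unit disc: it is analytic in the whole disc and, near each
point of the disc that is not a zero of `f`, it is `exp (α L)` for some analytic logarithm `L`
of `f`. (At the zeros of `f` the value of `G` is then forced by analyticity.) -/
def IsPowBranch (α : ℝ) (f G : ℂ → ℂ) : Prop :=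
  DifferentiableOn ℂ G (ball 0 1) ∧
    ∀ z ∈ ball (0 : ℂ) 1, f z ≠ 0 →
      ∃ L : ℂ → ℂ, AnalyticAt ℂ L z ∧
        ∀ᶠ w in 𝓝 z, Complex.exp (L w) = f w ∧ G w = Complex.exp (α * L w)

/-- The polynomial `h(z) = ∑ c_j z^j / j!`, with `h^(j)(0) = c_j`. -/
noncomputable def dataFun {N : ℕ} (c : Fin (N + 1) → ℂ) (z : ℂ) : ℂ :=
  ∑ j : Fin (N + 1), c j / (Nat.factorial j : ℂ) * z ^ (j : ℕ)

/-- The number `β_j^α(a; c_0, …, c_j)`: the `j`-th derivative at the origin of the branch of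
`h ^ α` near the origin that takes the value `a` there, where `h(z) = ∑ c_j z^j / j!`, `c_0 ≠ 0`
and `a` is a value of `c_0 ^ α`. As `h / c_0` is near `1` close to the origin, that branch is
`a (h / c_0) ^ α` with the principal power. -/
noncomputable def beta (α : ℝ) (a : ℂ) {N : ℕ} (c : Fin (N + 1) → ℂ) (j : ℕ) : ℂ :=
  iteratedDeriv j (fun z : ℂ => a * (dataFun c z / c 0) ^ (α : ℂ)) 0

/-- The polynomial `∑_{j ≤ N} β_j^α(a; c_0, …, c_j) z^j / j!`. -/
noncomputable def betaPoly (α : ℝ) (a : ℂ) {N : ℕ} (c : Fin (N + 1) → ℂ) : Polynomial ℂ :=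
  ∑ j ∈ Finset.range (N + 1),
    Polynomial.monomial j (beta α a c j / (Nat.factorial j : ℂ))

end BergmanExtremal

namespace BergmanExtremal

/-! Let `G` be the branch of `f ^ (2/p)` with `G 0 = c 0` and `g` a branch of `f ^ (1 - 2/p)`. Then
`G * g = κ * f` for a constant `κ ≠ 0` (`IsPowBranch.exists_mul_eq`) and `|G|^p = |f|^2`, so the
extremal kernel `|G|^p / G` equals `conj f * k` with `k = κ⁻¹ * g` analytic. As `f` has degree at
most `N`, this kernel annihilates every analytic function vanishing to order `N + 1` at the origin:
on `|z| = r`, `conj z = r^2 / z` (`circleAverage_conj_polynomial_mul`). Differences of interpolants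
are such functions, and the supporting-hyperplane inequality for `|z|^p` (`norm_rpow_add_le`),
integrated, gives minimality and uniqueness of `G`. That `G` interpolates is a statement about
contact: `f` agrees with `h ^ (p/2)` to order `N + 1`, and passing to logarithms, scaling by `2/p`
and exponentiating preserves that order (`analyticOrderAt_exp_sub_exp`). -/

/-! ### Existence of branches of powers of polynomials. -/

theorem IsPowBranch.mul {α : ℝ} {f₁ f₂ G₁ G₂ : ℂ → ℂ} (h₁ : IsPowBranch α f₁ G₁)
    (h₂ : IsPowBranch α f₂ G₂) :
    IsPowBranch α (fun z => f₁ z * f₂ z) (fun z => G₁ z * G₂ z) := by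
  refine ⟨h₁.1.mul h₂.1, fun z hz hne => ?_⟩
  obtain ⟨L₁, hL₁, e₁⟩ := h₁.2 z hz (left_ne_zero_of_mul hne)
  obtain ⟨L₂, hL₂, e₂⟩ := h₂.2 z hz (right_ne_zero_of_mul hne)
  refine ⟨fun w => L₁ w + L₂ w, hL₁.add hL₂, ?_⟩
  filter_upwards [e₁, e₂] with w h1 h2
  rw [Complex.exp_add, h1.1, h2.1, h1.2, h2.2, mul_add, Complex.exp_add]
  exact ⟨rfl, rfl⟩

theorem isPowBranch_exp (α : ℝ) {L : ℂ → ℂ} (hL : DifferentiableOn ℂ L (ball 0 1)) :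
    IsPowBranch α (fun z => Complex.exp (L z)) (fun z => Complex.exp (α * L z)) := by
  refine ⟨(hL.const_mul _).cexp, fun z hz _ => ⟨L, ?_, Eventually.of_forall fun w => ⟨rfl, rfl⟩⟩⟩
  exact hL.analyticAt (isOpen_ball.mem_nhds hz)

theorem IsPowBranch.congr {α : ℝ} {f f' G : ℂ → ℂ} (h : IsPowBranch α f G)
    (hf : EqOn f f' (ball 0 1)) : IsPowBranch α f' G := by
  refine ⟨h.1, fun z hz hne => ?_⟩
  obtain ⟨L, hL, e⟩ := h.2 z hz (by rwa [hf hz])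
  refine ⟨L, hL, ?_⟩
  filter_upwards [e, isOpen_ball.mem_nhds hz] with w hw hwb
  rwa [← hf hwb]

theorem exists_isPowBranch_const (α : ℝ) {b : ℂ} (hb : b ≠ 0) :
    ∃ G, IsPowBranch α (fun _ => b) G := by
  refine ⟨_, (isPowBranch_exp α (L := fun _ => Complex.log b)
    (differentiableOn_const _)).congr fun z _ => ?_⟩
  simp [Complex.exp_log hb]

/-- A power of a linear factor whose root lies outside the disc has a branch of every power. -/
theorem exists_isPowBranch_linear_pow_of_one_le_norm (α : ℝ) {a : ℂ} (ha : 1 ≤ ‖a‖) (m : ℕ) :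
    ∃ G, IsPowBranch α (fun z => (z - a) ^ m) G := by
  have ha0 : a ≠ 0 := norm_pos_iff.1 (by linarith)
  -- Writing `z - a = -a * (1 - z / a)` keeps the second factor in the right half-plane, where the
  -- principal logarithm is analytic.
  have hs : ∀ z ∈ ball (0 : ℂ) 1, 1 - z / a ∈ Complex.slitPlane := by
    intro z hz
    refine Or.inl ?_
    have h1 : ‖z / a‖ < 1 := by
      rw [norm_div, div_lt_one (by linarith)]
      exact lt_of_lt_of_le (by simpa using hz) ha
    have h2 := (Complex.re_le_norm (z / a)).trans_lt h1
    simpa using h2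
  refine ⟨_, (isPowBranch_exp α (L := fun z => m * (Complex.log (1 - z / a) + Complex.log (-a)))
    ?_).congr fun z hz => ?_⟩
  · have hlog : DifferentiableOn ℂ (fun z => Complex.log (1 - z / a)) (ball 0 1) :=
      DifferentiableOn.clog (by fun_prop) hs
    fun_prop
  · simp only
    rw [Complex.exp_nat_mul, Complex.exp_add, Complex.exp_log (Complex.slitPlane_ne_zero (hs z hz)),
      Complex.exp_log (neg_ne_zero.2 ha0)]
    congr 1
    field_simp
    ring

/-- A power `(z - a) ^ m` has a branch of its power with exponent `n / m`. -/
theorem isPowBranch_linear_pow {α : ℝ} (a : ℂ) {m n : ℕ} (h : α * m = n) (hm : m ≠ 0) :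
    IsPowBranch α (fun z => (z - a) ^ m) (fun z => (z - a) ^ n) := by
  refine ⟨by fun_prop, fun z _ hne => ?_⟩
  have hza : z - a ≠ 0 := fun h0 => hne (by simp [h0, hm])
  have hd : ∀ᶠ w in 𝓝 z, (w - a) / (z - a) ∈ Complex.slitPlane := by
    have : ContinuousAt (fun w : ℂ => (w - a) / (z - a)) z := by fun_prop
    refine this.eventually_mem (Complex.isOpen_slitPlane.mem_nhds ?_)
    simp [div_self hza]
  refine ⟨fun w => m * (Complex.log ((w - a) / (z - a)) + Complex.log (z - a)), ?_, ?_⟩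
  · refine analyticAt_const.mul (AnalyticAt.add (AnalyticAt.clog (by fun_prop) hd.self_of_nhds)
      analyticAt_const)
  · filter_upwards [hd] with w hw
    have he : Complex.exp (Complex.log ((w - a) / (z - a)) + Complex.log (z - a)) = w - a := by
      rw [Complex.exp_add, Complex.exp_log (Complex.slitPlane_ne_zero hw), Complex.exp_log hza]
      field_simp
    have h' : (α : ℂ) * m = n := by exact_mod_cast h
    rw [← mul_assoc, h', Complex.exp_nat_mul, Complex.exp_nat_mul, he]
    exact ⟨rfl, rfl⟩

theorem exists_isPowBranch_finset_prod {ι : Type*} (α : ℝ) (s : Finset ι) (f : ι → ℂ → ℂ)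
    (h : ∀ i ∈ s, ∃ G, IsPowBranch α (f i) G) :
    ∃ G, IsPowBranch α (fun z => ∏ i ∈ s, f i z) G := by
  classical
  induction s using Finset.induction_on with
  | empty => simpa using exists_isPowBranch_const α one_ne_zero
  | insert i s hi ih =>
    obtain ⟨G₁, h₁⟩ := h i (Finset.mem_insert_self i s)
    obtain ⟨G₂, h₂⟩ := ih fun j hj => h j (Finset.mem_insert_of_mem hj)
    refine ⟨_, (h₁.mul h₂).congr fun z _ => ?_⟩
    simp [Finset.prod_insert hi]

theorem exists_isPowBranch_polynomial {α : ℝ} (hα : 0 ≤ α) {f : Polynomial ℂ} (hf : f ≠ 0)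
    (hzero : (∀ z ∈ ball (0 : ℂ) 1, f.eval z ≠ 0) ∨
      ∃ q : ℚ, (q : ℝ) = α ∧
        ∀ z ∈ ball (0 : ℂ) 1, f.eval z = 0 → q.den ∣ f.rootMultiplicity z) :
    ∃ G, IsPowBranch α (fun z => f.eval z) G := by
  classical
  obtain ⟨G₁, h₁⟩ := exists_isPowBranch_const α (Polynomial.leadingCoeff_ne_zero.2 hf)
  obtain ⟨G₂, h₂⟩ := exists_isPowBranch_finset_prod α f.roots.toFinset
    (fun a z => (z - a) ^ f.rootMultiplicity a) (by
      intro a ha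
      have hroot : f.eval a = 0 := (Polynomial.mem_roots hf).1 (Multiset.mem_toFinset.1 ha)
      by_cases hab : a ∈ ball (0 : ℂ) 1
      · obtain ⟨q, hq, hdvd⟩ := hzero.resolve_left fun h => h a hab hroot
        obtain ⟨m, hm⟩ := hdvd a hab hroot
        have hq0 : 0 ≤ q := by exact_mod_cast hq ▸ hα
        refine ⟨_, isPowBranch_linear_pow a (n := q.num.toNat * m) ?_
          ((Polynomial.rootMultiplicity_pos hf).2 hroot).ne'⟩
        have hn : ((q.num.toNat : ℤ) : ℝ) = q.num := by
          rw [Int.toNat_of_nonneg (Rat.num_nonneg.2 hq0)]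
        have hd : (q : ℝ) * q.den = q.num := by exact_mod_cast Rat.mul_den_eq_num q
        rw [hm, ← hq]
        push_cast at hn ⊢
        rw [hn, ← hd]
        ring
      · exact exists_isPowBranch_linear_pow_of_one_le_norm α (by simpa using hab) _)
  refine ⟨_, (h₁.mul h₂).congr fun z _ => ?_⟩
  have := (IsAlgClosed.splits f).eval_eq_prod_roots z
  simp only
  rw [this, Finset.prod_multiset_map_count]
  simp only [Polynomial.count_roots]

/-! ### Values, moduli and products of branches. -/

theorem IsPowBranch.const_mul_exp {α : ℝ} {f G : ℂ → ℂ} (h : IsPowBranch α f G) (n : ℤ) :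
    IsPowBranch α f (fun z => Complex.exp (α * (n * (2 * Real.pi * Complex.I))) * G z) := by
  refine ⟨h.1.const_mul _, fun z hz hne => ?_⟩
  obtain ⟨L, hL, e⟩ := h.2 z hz hne
  refine ⟨fun w => n * (2 * Real.pi * Complex.I) + L w, analyticAt_const.add hL, ?_⟩
  filter_upwards [e] with w hw
  rw [Complex.exp_add, Complex.exp_int_mul_two_pi_mul_I, mul_add, Complex.exp_add, hw.1, hw.2]
  simp

/-- Any value of the power at the origin is taken by some branch, as soon as there is a branch. -/
theorem IsPowBranch.exists_apply_zero {α : ℝ} {f G : ℂ → ℂ} (h : IsPowBranch α f G) {l : ℂ}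
    (hl : Complex.exp l = f 0) :
    ∃ G', IsPowBranch α f G' ∧ G' 0 = Complex.exp (α * l) := by
  obtain ⟨L, -, e⟩ := h.2 0 (by simp) (by rw [← hl]; exact Complex.exp_ne_zero _)
  obtain ⟨e₁, e₂⟩ := e.self_of_nhds
  obtain ⟨n, hn⟩ := Complex.exp_eq_exp_iff_exists_int.1 (hl.trans e₁.symm)
  refine ⟨_, h.const_mul_exp n, ?_⟩
  rw [e₂, ← Complex.exp_add, hn]
  ring_nf

theorem IsPowBranch.norm_eq {α : ℝ} {f G : ℂ → ℂ} (h : IsPowBranch α f G) {z : ℂ}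
    (hz : z ∈ ball (0 : ℂ) 1) (hne : f z ≠ 0) : ‖G z‖ = ‖f z‖ ^ α := by
  obtain ⟨L, -, e⟩ := h.2 z hz hne
  obtain ⟨e₁, e₂⟩ := e.self_of_nhds
  rw [← e₁, e₂, Complex.norm_exp, Complex.norm_exp, ← Real.exp_mul]
  simp [mul_comm]

/-- At zeros of `f` the logarithm is unavailable; the identity extends there by continuity, the
zeros being finite in number and `α ≥ 0` making the right side continuous. -/
theorem IsPowBranch.norm_eq_of_polynomial {α : ℝ} (hα : 0 ≤ α) {f : Polynomial ℂ} (hf : f ≠ 0)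
    {G : ℂ → ℂ} (h : IsPowBranch α (fun z => f.eval z) G) :
    ∀ z ∈ ball (0 : ℂ) 1, ‖G z‖ = ‖f.eval z‖ ^ α := by
  have hfin : {z : ℂ | f.eval z = 0}.Finite := by
    simpa [Polynomial.IsRoot] using Polynomial.finite_setOfPred_isRoot hf
  have hdense : Dense {z : ℂ | f.eval z = 0}ᶜ := hfin.countable.dense_compl ℂ
  refine EqOn.of_subset_closure (s := ball (0 : ℂ) 1 ∩ {z : ℂ | f.eval z = 0}ᶜ)
    (fun z hz => h.norm_eq hz.1 hz.2) h.1.continuousOn.norm ?_ inter_subset_left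
    (hdense.open_subset_closure_inter isOpen_ball)
  exact ((Polynomial.continuous f).norm.rpow_const fun _ => Or.inr hα).continuousOn

/-- A branch of `f ^ α` times a branch of `f ^ (1 - α)` is a constant multiple of `f`. -/
theorem IsPowBranch.exists_mul_eq {α : ℝ} {f G g : ℂ → ℂ}
    (hf : DifferentiableOn ℂ f (ball 0 1)) (hf0 : f 0 ≠ 0)
    (hG : IsPowBranch α f G) (hg : IsPowBranch (1 - α) f g) :
    ∃ κ : ℂ, κ ≠ 0 ∧ ∀ z ∈ ball (0 : ℂ) 1, G z * g z = κ * f z := by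
  have h0 : (0 : ℂ) ∈ ball (0 : ℂ) 1 := by simp
  obtain ⟨L₁, hL₁, e₁⟩ := hG.2 0 h0 hf0
  obtain ⟨L₂, hL₂, e₂⟩ := hg.2 0 h0 hf0
  obtain ⟨n, hn⟩ := Complex.exp_eq_exp_iff_exists_int.1
    (e₂.self_of_nhds.1.trans e₁.self_of_nhds.1.symm)
  -- Two logarithms of `f` differ by a multiple of `2πi`; these lie more than `1` apart, so
  -- continuity fixes the multiple near `0`.
  have hnear : ∀ᶠ w in 𝓝 (0 : ℂ), L₂ w - L₁ w = n * (2 * Real.pi * Complex.I) := by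
    have hc : ContinuousAt (fun w => L₂ w - L₁ w) 0 := hL₂.continuousAt.sub hL₁.continuousAt
    have hb := Metric.continuousAt_iff'.1 hc 1 one_pos
    filter_upwards [hb, e₁, e₂] with w hw h1 h2
    obtain ⟨k, hk⟩ := Complex.exp_eq_exp_iff_exists_int.1 (h2.1.trans h1.1.symm)
    have hkn : k = n := by
      by_contra hne
      have h3 : (1 : ℝ) ≤ |((k - n : ℤ) : ℝ)| := by
        exact_mod_cast Int.one_le_abs (sub_ne_zero.2 hne)
      have h4 : L₂ w - L₁ w - (L₂ 0 - L₁ 0) = ((k - n : ℤ) : ℂ) * (2 * Real.pi * Complex.I) := by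
        rw [hk, hn]; push_cast; ring
      have h5 : ‖((k - n : ℤ) : ℂ)‖ = |((k - n : ℤ) : ℝ)| := by
        rw [Complex.norm_intCast]
      rw [dist_eq_norm, h4, norm_mul, h5] at hw
      have h6 : ‖(2 * Real.pi * Complex.I : ℂ)‖ = 2 * Real.pi := by
        simp [Real.pi_pos.le]
      rw [h6] at hw
      nlinarith [Real.pi_gt_three]
    rw [hk, hkn]; ring
  refine ⟨Complex.exp ((1 - α) * (n * (2 * Real.pi * Complex.I))), Complex.exp_ne_zero _, ?_⟩
  have hev : (fun z => G z * g z) =ᶠ[𝓝 0]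
      fun z => Complex.exp ((1 - α) * (n * (2 * Real.pi * Complex.I))) * f z := by
    filter_upwards [hnear, e₁, e₂] with w hw h1 h2
    rw [h1.2, h2.2, ← h1.1, ← Complex.exp_add, ← Complex.exp_add, ← hw]
    congr 1
    push_cast
    ring
  exact ((hG.1.mul hg.1).analyticOnNhd isOpen_ball).eqOn_of_preconnected_of_eventuallyEq
    ((hf.const_mul _).analyticOnNhd isOpen_ball) (convex_ball _ _).isPreconnected h0 hev

/-! ### Orders of contact and the interpolation conditions. -/

theorem analyticOrderAt_exp_sub_one {u : ℂ → ℂ} {z : ℂ} (hu : AnalyticAt ℂ u z) (hz : u z = 0) :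
    analyticOrderAt (fun w => Complex.exp (u w) - 1) z = analyticOrderAt u z := by
  have h1 : analyticOrderAt (fun w : ℂ => Complex.exp w - 1) 0 = 1 := by
    have := AnalyticAt.analyticOrderAt_sub_eq_one_of_deriv_ne_zero
      (f := Complex.exp) (x := (0 : ℂ)) (by fun_prop) (by simp)
    simpa using this
  have h2 := AnalyticAt.analyticOrderAt_comp (f := fun w : ℂ => Complex.exp w - 1) (g := u)
    (z₀ := z) (by fun_prop) hu
  rw [hz, h1, one_mul] at h2
  simpa [Function.comp_def] using h2

/-- Factor out `exp v`, which has no zeros, and use that `exp w - 1` has a simple zero at `0`. The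
hypothesis `u z = v z` rules out an offset by a multiple of `2πi`. -/
theorem analyticOrderAt_exp_sub_exp {u v : ℂ → ℂ} {z : ℂ} (hu : AnalyticAt ℂ u z)
    (hv : AnalyticAt ℂ v z) (hz : u z = v z) :
    analyticOrderAt (fun w => Complex.exp (u w) - Complex.exp (v w)) z =
      analyticOrderAt (fun w => u w - v w) z := by
  have h : (fun w => Complex.exp (u w) - Complex.exp (v w)) =
      (fun w => Complex.exp (v w)) * fun w => Complex.exp (u w - v w) - 1 := by
    ext w
    simp only [Pi.mul_apply]
    rw [Complex.exp_sub, mul_sub, mul_div_cancel₀ _ (Complex.exp_ne_zero _), mul_one]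
  have h0 : analyticOrderAt (fun w => Complex.exp (v w)) z = 0 :=
    (AnalyticAt.analyticOrderAt_eq_zero (by fun_prop)).2 (Complex.exp_ne_zero _)
  rw [h, analyticOrderAt_mul (by fun_prop) (by fun_prop), h0, zero_add,
    analyticOrderAt_exp_sub_one (hu.fun_sub hv) (by simp [hz])]

theorem dataFun_zero {N : ℕ} (c : Fin (N + 1) → ℂ) : dataFun c 0 = c 0 := by
  rw [dataFun, Finset.sum_eq_single (0 : Fin (N + 1))]
  · simp
  · intro j _ hj
    have : (j : ℕ) ≠ 0 := fun h => hj (Fin.ext h)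
    simp [this]
  · simp

theorem differentiable_dataFun {N : ℕ} (c : Fin (N + 1) → ℂ) : Differentiable ℂ (dataFun c) := by
  unfold dataFun
  fun_prop

theorem iteratedDeriv_dataFun {N : ℕ} (c : Fin (N + 1) → ℂ) (j : Fin (N + 1)) :
    iteratedDeriv j (dataFun c) 0 = c j := by
  unfold dataFun
  simp (disch := fun_prop) only [iteratedDeriv_fun_sum, iteratedDeriv_const_mul_field,
    iteratedDeriv_fun_pow_zero]
  rw [Finset.sum_eq_single j]
  · simp [Nat.factorial_ne_zero]
  · intro i _ hij
    have : (i : ℕ) ≠ j := fun h => hij (Fin.ext h)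
    simp [this.symm]
  · simp

theorem analyticAt_powFun {N : ℕ} {c : Fin (N + 1) → ℂ} (hc : c 0 ≠ 0) (α : ℝ) (a : ℂ) :
    AnalyticAt ℂ (fun z : ℂ => a * (dataFun c z / c 0) ^ (α : ℂ)) 0 := by
  have := (differentiable_dataFun c).analyticAt 0
  refine analyticAt_const.mul (AnalyticAt.cpow (by fun_prop) analyticAt_const ?_)
  simp [dataFun_zero, hc]

/-- The polynomial agrees to order `N + 1` with the branch whose Taylor polynomial it is. -/
theorem le_analyticOrderAt_betaPoly_sub {N : ℕ} {c : Fin (N + 1) → ℂ} (hc : c 0 ≠ 0) (α : ℝ)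
    (a : ℂ) :
    ((N + 1 : ℕ) : ℕ∞) ≤ analyticOrderAt
      (fun z => (betaPoly α a c).eval z - a * (dataFun c z / c 0) ^ (α : ℂ)) 0 := by
  obtain ⟨F, hF, e⟩ := (analyticAt_powFun hc α a).exists_eventuallyEq_sum_add_pow_mul (N + 1)
  refine (natCast_le_analyticOrderAt ?_).2 ⟨fun z => - F z, hF.neg, ?_⟩
  · exact AnalyticAt.sub ((Polynomial.differentiable _).analyticAt _) (analyticAt_powFun hc α a)
  · filter_upwards [e] with z hz
    rw [hz, betaPoly, Polynomial.eval_finsetSum]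
    simp only [Polynomial.eval_monomial, smul_eq_mul, sub_zero, beta]
    have : ∀ x ∈ Finset.range (N + 1),
      iteratedDeriv x (fun z ↦ a * (dataFun c z / c 0) ^ (α : ℂ)) 0 / (Nat.factorial x : ℂ) * z ^ x
       = z ^ x / (Nat.factorial x : ℂ) *
        iteratedDeriv x (fun z ↦ a * (dataFun c z / c 0) ^ (α : ℂ)) 0 := fun x _ => by ring
    rw [Finset.sum_congr rfl this]
    ring

theorem betaPoly_eval_zero {N : ℕ} {c : Fin (N + 1) → ℂ} (hc : c 0 ≠ 0) (α : ℝ) (a : ℂ) :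
    (betaPoly α a c).eval 0 = a := by
  rw [betaPoly, Polynomial.eval_finsetSum, Finset.sum_eq_single 0]
  · simp [beta, dataFun_zero, hc]
  · intro j _ hj
    simp [hj]
  · simp

theorem natDegree_betaPoly_le {N : ℕ} (c : Fin (N + 1) → ℂ) (α : ℝ) (a : ℂ) :
    (betaPoly α a c).natDegree ≤ N := by
  refine Polynomial.natDegree_sum_le_of_forall_le _ _ fun j hj => ?_
  exact (Polynomial.natDegree_monomial_le _).trans (Nat.lt_succ_iff.1 (Finset.mem_range.1 hj))

/-- The branch of the power `1 / α` of the polynomial takes the prescribed derivatives. -/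
theorem IsPowBranch.le_analyticOrderAt_sub_dataFun {N : ℕ} {c : Fin (N + 1) → ℂ} (hc : c 0 ≠ 0)
    {α β : ℝ} (hαβ : β * α = 1) {a : ℂ} (ha : a ≠ 0) {G : ℂ → ℂ}
    (hG : IsPowBranch β (fun z => (betaPoly α a c).eval z) G) (hG0 : G 0 = c 0) :
    ((N + 1 : ℕ) : ℕ∞) ≤ analyticOrderAt (fun z => G z - dataFun c z) 0 := by
  obtain ⟨L, hL, e⟩ := hG.2 0 (by simp) (by simpa [betaPoly_eval_zero hc] using ha)
  have e0 := e.self_of_nhds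
  simp only [betaPoly_eval_zero hc, hG0] at e0
  -- A logarithm of the branch of `h ^ α`, with the additive constant chosen so that it equals `L`
  -- at the origin.
  set M : ℂ → ℂ := fun z => L 0 + α * Complex.log (dataFun c z / c 0) with hM
  have hdat := (differentiable_dataFun c).analyticAt 0
  have hMa : AnalyticAt ℂ M 0 := by
    refine analyticAt_const.add (analyticAt_const.mul (AnalyticAt.clog (by fun_prop) ?_))
    simp [dataFun_zero, hc]
  have hM0 : L 0 = M 0 := by simp [hM, dataFun_zero, hc]
  have hne : ∀ᶠ z in 𝓝 (0 : ℂ), dataFun c z ≠ 0 :=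
    hdat.continuousAt.eventually_ne (by simpa [dataFun_zero] using hc)
  have h1 := le_analyticOrderAt_betaPoly_sub hc α a
  have h2 : (fun z => (betaPoly α a c).eval z - a * (dataFun c z / c 0) ^ (α : ℂ)) =ᶠ[𝓝 0]
      fun z => Complex.exp (L z) - Complex.exp (M z) := by
    filter_upwards [e, hne] with z hz hz'
    rw [hz.1, hM, Complex.exp_add, e0.1, Complex.cpow_def_of_ne_zero (div_ne_zero hz' hc),
      mul_comm (Complex.log _)]
  have h3 : (fun z => G z - dataFun c z) =ᶠ[𝓝 0]
      fun z => Complex.exp (β * L z) - Complex.exp (β * M z) := by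
    filter_upwards [e, hne] with z hz hz'
    have hab : (β : ℂ) * α = 1 := by exact_mod_cast hαβ
    rw [hz.2, hM]
    simp only
    rw [mul_add, Complex.exp_add, ← e0.2, ← mul_assoc, hab, one_mul,
      Complex.exp_log (div_ne_zero hz' hc), mul_div_cancel₀ _ hc]
  have hβ : (β : ℂ) ≠ 0 := by
    exact_mod_cast left_ne_zero_of_mul (hαβ.trans_ne one_ne_zero)
  rw [analyticOrderAt_congr h2, analyticOrderAt_exp_sub_exp hL hMa hM0] at h1
  rw [analyticOrderAt_congr h3, analyticOrderAt_exp_sub_exp (by fun_prop) (by fun_prop)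
    (by rw [hM0])]
  have h4 : (fun w => β * L w - β * M w) = (fun _ => (β : ℂ)) * fun w => L w - M w := by
    ext w; simp [mul_sub]
  rw [h4, analyticOrderAt_mul analyticAt_const (by fun_prop)]
  exact h1.trans le_add_self

theorem iteratedDeriv_eq_of_le_analyticOrderAt_sub {F G : ℂ → ℂ} {z : ℂ} (hF : AnalyticAt ℂ F z)
    (hG : AnalyticAt ℂ G z) {n : ℕ} :
    (n : ℕ∞) ≤ analyticOrderAt (fun w => F w - G w) z ↔
      ∀ i < n, iteratedDeriv i F z = iteratedDeriv i G z := by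
  rw [natCast_le_analyticOrderAt_iff_iteratedDeriv_eq_zero (hF.fun_sub hG)]
  refine forall₂_congr fun i _ => ?_
  rw [iteratedDeriv_fun_sub hF.contDiffAt hG.contDiffAt, sub_eq_zero]

/-! ### Orthogonality of the kernel to functions vanishing at the origin. -/

/-- An analytic function with a zero of order at least `n` at the origin is divisible by `z ^ n`
in the disc. -/
theorem exists_eq_pow_mul {H : ℂ → ℂ} (hH : DifferentiableOn ℂ H (ball 0 1)) {n : ℕ}
    (hn : (n : ℕ∞) ≤ analyticOrderAt H 0) :
    ∃ K : ℂ → ℂ, DifferentiableOn ℂ K (ball 0 1) ∧ ∀ z, z ≠ 0 → H z = z ^ n * K z := by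
  have h0 : ball (0 : ℂ) 1 ∈ 𝓝 0 := isOpen_ball.mem_nhds (by simp)
  obtain ⟨F, hF, e⟩ := (natCast_le_analyticOrderAt (hH.analyticAt h0)).1 hn
  simp only [sub_zero, smul_eq_mul] at e
  -- The value `F 0` of the local cofactor removes the singularity of `H z / z ^ n`.
  refine ⟨Function.update (fun z => H z / z ^ n) 0 (F 0), fun z hz => ?_, fun z hz => ?_⟩
  · refine DifferentiableAt.differentiableWithinAt ?_
    rcases eq_or_ne z 0 with rfl | hz0
    · refine hF.differentiableAt.congr_of_eventuallyEq ?_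
      filter_upwards [e] with w hw
      rcases eq_or_ne w 0 with rfl | hw0
      · simp
      · rw [Function.update_of_ne hw0, hw]
        field_simp
    · have hd : DifferentiableAt ℂ (fun z => H z / z ^ n) z :=
        ((hH z hz).differentiableAt (isOpen_ball.mem_nhds hz)).div (by fun_prop) (pow_ne_zero _ hz0)
      refine hd.congr_of_eventuallyEq ?_
      filter_upwards [isOpen_ne.mem_nhds hz0] with w hw
      rw [Function.update_of_ne hw]
  · rw [Function.update_of_ne hz]
    field_simp

/-- On the circle `conj z ^ j * z ^ (N + 1) = r ^ (2 * j) * z ^ (N + 1 - j)`, so the integrand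
agrees with an analytic function, to which the mean value property applies. It vanishes at `0`
because `j ≤ N` leaves a positive exponent. -/
theorem circleAverage_conj_polynomial_mul {N : ℕ} {f : Polynomial ℂ} (hf : f.natDegree ≤ N)
    {H : ℂ → ℂ} (hH : DifferentiableOn ℂ H (ball 0 1))
    (hn : ((N + 1 : ℕ) : ℕ∞) ≤ analyticOrderAt H 0) {r : ℝ} (hr0 : 0 < r) (hr1 : r < 1) :
    Real.circleAverage (fun z => (starRingEnd ℂ) (f.eval z) * H z) 0 r = 0 := by
  obtain ⟨K, hK, e⟩ := exists_eq_pow_mul hH hn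
  have hcongr : Real.circleAverage (fun z => (starRingEnd ℂ) (f.eval z) * H z) 0 r =
      Real.circleAverage (fun z => (∑ j ∈ Finset.range (N + 1),
        (starRingEnd ℂ) (f.coeff j) * (r : ℂ) ^ (2 * j) * z ^ (N + 1 - j)) * K z) 0 r := by
    refine Real.circleAverage_congr_sphere fun z hz => ?_
    have hzr : ‖z‖ = r := by simpa [abs_of_pos hr0] using hz
    have hz0 : z ≠ 0 := norm_pos_iff.1 (hzr ▸ hr0)
    have hzz : (starRingEnd ℂ) z * z = (r : ℂ) ^ 2 := by rw [Complex.conj_mul', hzr]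
    rw [e z hz0, ← mul_assoc, Polynomial.eval_eq_sum_range' (Nat.lt_succ_of_le hf), map_sum,
      Finset.sum_mul]
    congr 1
    refine Finset.sum_congr rfl fun j hj => ?_
    have hjN : j ≤ N + 1 := (Finset.mem_range.1 hj).le
    rw [map_mul, map_pow, pow_mul, ← hzz, mul_pow, mul_assoc, mul_assoc, mul_assoc, ← pow_add,
      Nat.add_sub_cancel' hjN]
  rw [hcongr, DiffContOnCl.circleAverage]
  · have : (∑ j ∈ Finset.range (N + 1),
        (starRingEnd ℂ) (f.coeff j) * (r : ℂ) ^ (2 * j) * (0 : ℂ) ^ (N + 1 - j)) = 0 :=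
      Finset.sum_eq_zero fun j hj => by
        rw [zero_pow (Nat.sub_ne_zero_of_lt (Finset.mem_range.1 hj)), mul_zero]
    rw [this, zero_mul]
  · refine DifferentiableOn.diffContOnCl (DifferentiableOn.mul (by fun_prop) (hK.mono ?_))
    rw [abs_of_pos hr0, closure_ball _ hr0.ne']
    exact closedBall_subset_ball hr1

/-- A function on the disc whose averages over all circles about the origin vanish has vanishing
integral. -/
theorem setIntegral_ball_eq_zero_of_circleAverage {Φ : ℂ → ℂ}
    (h : ∀ r : ℝ, 0 < r → r < 1 → Real.circleAverage Φ 0 r = 0) :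
    ∫ z in ball (0 : ℂ) 1, Φ z = 0 := by
  set Ψ := (ball (0 : ℂ) 1).indicator Φ
  rw [← integral_indicator measurableSet_ball, ← Complex.integral_comp_polarCoord_symm,
    _root_.polarCoord_target]
  -- No integrability is needed: without it the integral is `0` by convention.
  by_cases hint : IntegrableOn (fun p : ℝ × ℝ => p.1 • Ψ (Complex.polarCoord.symm p))
      (Ioi (0 : ℝ) ×ˢ Ioo (-Real.pi) Real.pi) (volume.prod volume)
  · rw [Measure.volume_eq_prod, setIntegral_prod _ hint]
    refine setIntegral_eq_zero_of_forall_eq_zero fun r hr => ?_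
    have hr0 : 0 < r := hr
    have hsymm : ∀ θ : ℝ, Complex.polarCoord.symm (r, θ) = circleMap 0 r θ := fun θ => by
      rw [Complex.polarCoord_symm_apply, circleMap_zero, Complex.exp_mul_I]
      simp
    simp only [hsymm]
    by_cases hr1 : r < 1
    · have hmem : ∀ θ : ℝ, Ψ (circleMap 0 r θ) = Φ (circleMap 0 r θ) := fun θ =>
        indicator_of_mem (by simpa [abs_of_pos hr0] using hr1) _
      simp only [hmem]
      rw [integral_smul, ← integral_Ioc_eq_integral_Ioo,
        ← intervalIntegral.integral_of_le (by linarith [Real.pi_pos])]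
      have hper : Function.Periodic (fun θ => Φ (circleMap 0 r θ)) (2 * Real.pi) :=
        fun θ => by simp only [periodic_circleMap 0 r θ]
      have hshift := hper.intervalIntegral_add_eq (-Real.pi) 0
      rw [show -Real.pi + 2 * Real.pi = Real.pi by ring, zero_add] at hshift
      have havg := h r hr0 hr1
      rw [Real.circleAverage_def, smul_eq_zero] at havg
      rw [hshift, havg.resolve_left (by positivity), smul_zero]
    · have hmem : ∀ θ : ℝ, Ψ (circleMap 0 r θ) = 0 := fun θ =>
        indicator_of_notMem (by simpa [abs_of_pos hr0] using hr1) _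
      simp [hmem]
  · exact integral_undef hint

/-! ### Convexity of the `p`-th power of the modulus. -/

/-- The supporting-hyperplane inequality for the convex function `|z| ^ p`. -/
theorem norm_rpow_add_le {p : ℝ} (hp : 1 < p) {a b m : ℂ} (hm : m * a = ((‖a‖ ^ p : ℝ) : ℂ))
    (hm0 : a = 0 → m = 0) :
    ‖a‖ ^ p + p * (m * (b - a)).re ≤ ‖b‖ ^ p ∧
      (‖b‖ ^ p = ‖a‖ ^ p + p * (m * (b - a)).re → b = a) := by
  rcases eq_or_ne a 0 with rfl | ha
  · have hp0 : p ≠ 0 := by linarith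
    simp only [hm0 rfl, norm_zero, Real.zero_rpow hp0, zero_mul, Complex.zero_re, mul_zero,
      add_zero]
    exact ⟨by positivity, fun h => by
      simpa using (Real.rpow_eq_zero (norm_nonneg b) hp0).1 h⟩
  -- After scaling by `a` this is Bernoulli: `|w|^p ≥ 1 + p(|w| - 1) ≥ 1 + p(Re w - 1)`. Equality
  -- forces `|w| = 1` and `Re w = |w|`, so `w = 1`.
  · obtain ⟨w, rfl⟩ : ∃ w, b = w * a := ⟨b / a, (div_mul_cancel₀ _ ha).symm⟩
    have hx : 0 < ‖a‖ ^ p := by positivity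
    have hre : (m * (w * a - a)).re = ‖a‖ ^ p * (w.re - 1) := by
      rw [show m * (w * a - a) = (m * a) * (w - 1) by ring, hm, Complex.re_ofReal_mul]
      simp
    rw [hre, norm_mul, Real.mul_rpow (norm_nonneg _) (norm_nonneg _)]
    have hw := Complex.re_le_norm w
    have hB := one_add_mul_self_le_rpow_one_add (s := ‖w‖ - 1) (by linarith [norm_nonneg w]) hp.le
    rw [add_sub_cancel] at hB
    have hp0 : 0 < p := by linarith
    have h1 : p * w.re ≤ p * ‖w‖ := mul_le_mul_of_nonneg_left hw hp0.le
    refine ⟨by nlinarith, fun h => ?_⟩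
    have h2 : ‖w‖ ^ p = 1 + p * (w.re - 1) := mul_right_cancel₀ hx.ne' (by linarith)
    have h3 : w.re = ‖w‖ := le_antisymm hw (by nlinarith)
    have h4 : ‖w‖ = 1 := by
      by_contra hne
      have := one_add_mul_self_lt_rpow_one_add (s := ‖w‖ - 1) (by linarith [norm_nonneg w])
        (sub_ne_zero.2 hne) hp
      rw [add_sub_cancel] at this
      rw [h2, h3] at this
      exact lt_irrefl _ this
    have h5 : w = 1 := by
      have := Complex.re_eq_norm.1 h3
      rw [Complex.nonneg_iff] at this
      apply Complex.ext
      · simp [h3, h4]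
      · simp [← this.2]
    rw [h5, one_mul]

/-- The linear term integrates to `0`. In the equality case a nonnegative function has zero
integral, so the pointwise equality case holds almost everywhere. -/
theorem integral_norm_rpow_le {X : Type*} [MeasurableSpace X] {μ : Measure X} {p : ℝ} (hp : 1 < p)
    {F G M : X → ℂ} (hF : Integrable (fun x => ‖F x‖ ^ p) μ)
    (hG : Integrable (fun x => ‖G x‖ ^ p) μ)
    (hM : ∀ᵐ x ∂μ, M x * G x = ((‖G x‖ ^ p : ℝ) : ℂ) ∧ (G x = 0 → M x = 0))
    (hint : Integrable (fun x => M x * (F x - G x)) μ)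
    (h0 : ∫ x, M x * (F x - G x) ∂μ = 0) :
    ∫ x, ‖G x‖ ^ p ∂μ ≤ ∫ x, ‖F x‖ ^ p ∂μ ∧
      (∫ x, ‖F x‖ ^ p ∂μ = ∫ x, ‖G x‖ ^ p ∂μ → F =ᵐ[μ] G) := by
  have hre : Integrable (fun x => p * (M x * (F x - G x)).re) μ := hint.re.const_mul p
  have hre0 : ∫ x, p * (M x * (F x - G x)).re ∂μ = 0 := by
    rw [integral_const_mul]
    have := integral_re hint
    simp only [RCLike.re_to_complex] at this
    rw [this, h0]
    simp
  have hsum : ∫ x, (‖F x‖ ^ p - (‖G x‖ ^ p + p * (M x * (F x - G x)).re)) ∂μ =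
      ∫ x, ‖F x‖ ^ p ∂μ - ∫ x, ‖G x‖ ^ p ∂μ := by
    rw [integral_sub hF (hG.fun_add hre), integral_add hG hre, hre0, add_zero]
  have hnn : 0 ≤ᵐ[μ] fun x => ‖F x‖ ^ p - (‖G x‖ ^ p + p * (M x * (F x - G x)).re) := by
    filter_upwards [hM] with x hx
    exact sub_nonneg.2 (norm_rpow_add_le hp hx.1 hx.2).1
  refine ⟨sub_nonneg.1 (hsum ▸ integral_nonneg_of_ae hnn), fun heq => ?_⟩
  have hz := (integral_eq_zero_iff_of_nonneg_ae hnn (hF.sub (hG.add hre))).1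
    (hsum.trans (sub_eq_zero.2 heq))
  filter_upwards [hM, hz] with x hx hx'
  exact (norm_rpow_add_le hp hx.1 hx.2).2 (sub_eq_zero.1 hx')

/-! ### The disc measure and Bergman norms. -/

instance : IsFiniteMeasure discMeasure := by
  refine ⟨?_⟩
  rw [discMeasure, Measure.smul_apply, Measure.restrict_apply_univ, smul_eq_mul,
    ENNReal.inv_mul_cancel (measure_ball_pos _ _ one_pos).ne' measure_ball_lt_top.ne]
  exact ENNReal.one_lt_top

theorem ae_discMeasure : ae discMeasure = ae (volume.restrict (ball (0 : ℂ) 1)) :=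
  Measure.ae_ennreal_smul_measure_eq (ENNReal.inv_ne_zero.2 measure_ball_lt_top.ne) _

theorem ae_discMeasure_mem_ball : ∀ᵐ z ∂discMeasure, z ∈ ball (0 : ℂ) 1 := by
  rw [ae_discMeasure]
  exact ae_restrict_mem measurableSet_ball

theorem aestronglyMeasurable_discMeasure_of_continuousOn {F : ℂ → ℂ}
    (hF : ContinuousOn F (ball 0 1)) : AEStronglyMeasurable F discMeasure :=
  (hF.aestronglyMeasurable measurableSet_ball).smul_measure _

theorem eqOn_ball_of_ae_eq {F G : ℂ → ℂ} (hF : ContinuousOn F (ball 0 1))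
    (hG : ContinuousOn G (ball 0 1)) (h : F =ᵐ[discMeasure] G) : EqOn F G (ball 0 1) := by
  rw [EventuallyEq, ae_discMeasure] at h
  exact Measure.eqOn_open_of_ae_eq h isOpen_ball hF hG

theorem integral_discMeasure_conj_polynomial_mul {N : ℕ} {f : Polynomial ℂ} (hf : f.natDegree ≤ N)
    {H : ℂ → ℂ} (hH : DifferentiableOn ℂ H (ball 0 1))
    (hn : ((N + 1 : ℕ) : ℕ∞) ≤ analyticOrderAt H 0) :
    ∫ z, (starRingEnd ℂ) (f.eval z) * H z ∂discMeasure = 0 := by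
  rw [discMeasure, integral_smul_measure, setIntegral_ball_eq_zero_of_circleAverage
    fun r hr0 hr1 => circleAverage_conj_polynomial_mul hf hH hn hr0 hr1, smul_zero]

theorem MemBergman.integrable {p : ℝ} (hp : 1 < p) {F : ℂ → ℂ} (hF : MemBergman p F) :
    Integrable (fun z => ‖F z‖ ^ p) discMeasure := by
  have hp0 : 0 < p := by linarith
  have := hF.2.integrable_norm_rpow (by simpa using hp0) ENNReal.ofReal_ne_top
  rwa [ENNReal.toReal_ofReal hp0.le] at this

theorem MemBergman.bergmanNorm_eq {p : ℝ} (hp : 1 < p) {F : ℂ → ℂ} (hF : MemBergman p F) :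
    bergmanNorm p F = (∫ z, ‖F z‖ ^ p ∂discMeasure) ^ p⁻¹ := by
  have hp0 : 0 < p := by linarith
  rw [bergmanNorm, hF.2.eLpNorm_eq_integral_rpow_norm (by simpa using hp0) ENNReal.ofReal_ne_top,
    ENNReal.toReal_ofReal hp0.le, ENNReal.toReal_ofReal (by positivity)]

theorem memBergman_of_bounded {p : ℝ} {F : ℂ → ℂ} (hF : DifferentiableOn ℂ F (ball 0 1)) (C : ℝ)
    (hC : ∀ z ∈ ball (0 : ℂ) 1, ‖F z‖ ≤ C) : MemBergman p F := by
  refine ⟨hF, MemLp.of_bound (aestronglyMeasurable_discMeasure_of_continuousOn hF.continuousOn) C ?_⟩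
  filter_upwards [ae_discMeasure_mem_ball] with z hz using hC z hz

theorem ae_eq_of_eqOn {F G : ℂ → ℂ} (h : EqOn F G (ball 0 1)) : F =ᵐ[discMeasure] G := by
  filter_upwards [ae_discMeasure_mem_ball] with z hz using h hz

theorem IsMinimalInterpolant.congr {p : ℝ} {N : ℕ} {c : Fin (N + 1) → ℂ} {F G : ℂ → ℂ}
    (hG : IsMinimalInterpolant p c G) (h : EqOn F G (ball 0 1)) : IsMinimalInterpolant p c F := by
  have hev : F =ᶠ[𝓝 0] G := by
    filter_upwards [ball_mem_nhds (0 : ℂ) one_pos] with z hz using h hz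
  refine ⟨⟨⟨hG.1.1.1.congr h, hG.1.1.2.ae_eq (ae_eq_of_eqOn h).symm⟩, fun j => ?_⟩, ?_⟩
  · rw [hev.iteratedDeriv_eq, hG.1.2]
  · rw [← hG.2, bergmanNorm, bergmanNorm, eLpNorm_congr_ae (ae_eq_of_eqOn h)]

/-! ### The extremal problem. -/

/-- The dual characterisation of the minimal interpolant, in the direction that yields existence
and uniqueness: `conj f * k` is a multiple of the extremal kernel of `G`. -/
theorem isMinimalInterpolant_iff_of_kernel {p : ℝ} (hp : 1 < p) {N : ℕ} {c : Fin (N + 1) → ℂ}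
    {f : Polynomial ℂ} (hf : f.natDegree ≤ N) {G k : ℂ → ℂ} (hG : G ∈ interpolants p c)
    (hk : DifferentiableOn ℂ k (ball 0 1)) (B : ℝ)
    (hB : ∀ z ∈ ball (0 : ℂ) 1, ‖(starRingEnd ℂ) (f.eval z) * k z‖ ≤ B)
    (hkG : ∀ z ∈ ball (0 : ℂ) 1,
      (starRingEnd ℂ) (f.eval z) * k z * G z = ((‖G z‖ ^ p : ℝ) : ℂ) ∧
        (G z = 0 → (starRingEnd ℂ) (f.eval z) * k z = 0)) (F : ℂ → ℂ) :
    IsMinimalInterpolant p c F ↔ EqOn F G (ball 0 1) := by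
  have hp0 : 0 < p := by linarith
  have h0 : ball (0 : ℂ) 1 ∈ 𝓝 0 := ball_mem_nhds _ one_pos
  have key : ∀ F ∈ interpolants p c,
      ∫ z, ‖G z‖ ^ p ∂discMeasure ≤ ∫ z, ‖F z‖ ^ p ∂discMeasure ∧
      (∫ z, ‖F z‖ ^ p ∂discMeasure = ∫ z, ‖G z‖ ^ p ∂discMeasure → F =ᵐ[discMeasure] G) := by
    intro F hF
    refine integral_norm_rpow_le hp (hF.1.integrable hp) (hG.1.integrable hp)
      (M := fun z => (starRingEnd ℂ) (f.eval z) * k z) ?_ ?_ ?_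
    · filter_upwards [ae_discMeasure_mem_ball] with z hz using hkG z hz
    · have h1 : Integrable (fun z => F z - G z) discMeasure :=
        (hF.1.2.sub hG.1.2).integrable (by simpa using hp.le)
      refine h1.bdd_mul (c := B) (aestronglyMeasurable_discMeasure_of_continuousOn ?_) ?_
      · exact (Complex.continuous_conj.comp (Polynomial.continuous f)).continuousOn.mul
          hk.continuousOn
      · filter_upwards [ae_discMeasure_mem_ball] with z hz using hB z hz
    · have hFa : AnalyticAt ℂ F 0 := hF.1.1.analyticAt h0
      have hGa : AnalyticAt ℂ G 0 := hG.1.1.analyticAt h0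
      have hord : ((N + 1 : ℕ) : ℕ∞) ≤ analyticOrderAt (fun z => F z - G z) 0 :=
        (iteratedDeriv_eq_of_le_analyticOrderAt_sub hFa hGa).2 fun i hi =>
          (hF.2 ⟨i, hi⟩).trans (hG.2 ⟨i, hi⟩).symm
      simp only [mul_assoc]
      refine integral_discMeasure_conj_polynomial_mul hf (hk.mul (hF.1.1.sub hG.1.1)) ?_
      have := analyticOrderAt_mul (hk.analyticAt h0) (hFa.fun_sub hGa)
      exact (hord.trans le_add_self).trans_eq this.symm
  have hleast : IsLeast (bergmanNorm p '' interpolants p c) (bergmanNorm p G) := by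
    refine ⟨mem_image_of_mem _ hG, ?_⟩
    rintro _ ⟨F, hF, rfl⟩
    rw [hF.1.bergmanNorm_eq hp, hG.1.bergmanNorm_eq hp]
    exact Real.rpow_le_rpow (by positivity) (key F hF).1 (by positivity)
  have hGmin : IsMinimalInterpolant p c G := ⟨hG, hleast.csInf_eq.symm⟩
  refine ⟨fun hF => ?_, hGmin.congr⟩
  have heq : bergmanNorm p F = bergmanNorm p G := hF.2.trans hGmin.2.symm
  rw [hF.1.1.bergmanNorm_eq hp, hG.1.bergmanNorm_eq hp] at heq
  have := (Real.rpow_left_inj (by positivity) (by positivity) (by positivity)).1 heq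
  exact eqOn_ball_of_ae_eq hF.1.1.1.continuousOn hG.1.1.continuousOn ((key F hF.1).2 this)

end BergmanExtremal

open BergmanExtremal

theorem mainTheorem6 (p : ℝ) (hp : 1 < p) (N : ℕ) (c : Fin (N + 1) → ℂ) (hc : c 0 ≠ 0)
    (a₀ : ℂ) (ha₀ : BergmanExtremal.IsPowValue (p / 2) (c 0) a₀)
    (f : Polynomial ℂ) (hf : f = BergmanExtremal.betaPoly (p / 2) a₀ c)
    (hpow : ∃ p₁ : ℝ, 1 < p₁ ∧ ∃ g : ℂ → ℂ,
      BergmanExtremal.IsPowBranch (1 - 2 / p) (fun z => f.eval z) g ∧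
        BergmanExtremal.MemBergman p₁ g)
    (hzero : (∀ z ∈ Metric.ball (0 : ℂ) 1, f.eval z ≠ 0) ∨
      ∃ q : ℚ, (q : ℝ) = 2 / p ∧
        ∀ z ∈ Metric.ball (0 : ℂ) 1, f.eval z = 0 → q.den ∣ f.rootMultiplicity z) :
    (∃ G : ℂ → ℂ,
      BergmanExtremal.IsPowBranch (2 / p) (fun z => f.eval z) G ∧ G 0 = c 0) ∧
    ∀ G : ℂ → ℂ,
      BergmanExtremal.IsPowBranch (2 / p) (fun z => f.eval z) G → G 0 = c 0 →
        ∀ F : ℂ → ℂ, BergmanExtremal.IsMinimalInterpolant p c F ↔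
          Set.EqOn F G (Metric.ball 0 1) := by
  obtain ⟨l, hl, rfl⟩ := ha₀
  obtain ⟨p₁, -, g, hg, -⟩ := hpow
  have hp0 : 0 < p := by linarith
  have hα : 0 ≤ 2 / p := by positivity
  have hαβ : 2 / p * (p / 2) = 1 := by field_simp
  have hf0 : f.eval 0 = Complex.exp ((p / 2 : ℝ) * l) := by rw [hf, betaPoly_eval_zero hc]
  have hf0' : f.eval 0 ≠ 0 := hf0 ▸ Complex.exp_ne_zero _
  have hfne : f ≠ 0 := fun h => hf0' (by simp [h])
  refine ⟨?_, fun G hG hG0 => ?_⟩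
  · obtain ⟨G, hG⟩ := exists_isPowBranch_polynomial hα hfne hzero
    obtain ⟨G', hG', h0⟩ := hG.exists_apply_zero hf0.symm
    refine ⟨G', hG', ?_⟩
    have : ((2 / p : ℝ) : ℂ) * ((p / 2 : ℝ) : ℂ) = 1 := by exact_mod_cast hαβ
    rw [h0, ← mul_assoc, this, one_mul, hl]
  · have hnorm := hG.norm_eq_of_polynomial hα hfne
    obtain ⟨κ, hκ, hmul⟩ := hG.exists_mul_eq (Polynomial.differentiable f).differentiableOn hf0' hg
    obtain ⟨C, hC⟩ := (isCompact_closedBall (0 : ℂ) 1).exists_bound_of_continuousOn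
      (Polynomial.continuous f).continuousOn
    have hCb : ∀ z ∈ ball (0 : ℂ) 1, ‖f.eval z‖ ≤ C := fun z hz => hC z (ball_subset_closedBall hz)
    have hGC : ∀ z ∈ ball (0 : ℂ) 1, ‖G z‖ ≤ C ^ (2 / p) := fun z hz => by
      rw [hnorm z hz]
      exact Real.rpow_le_rpow (norm_nonneg _) (hCb z hz) hα
    have hzeroG : ∀ z ∈ ball (0 : ℂ) 1, G z = 0 → f.eval z = 0 := fun z hz h => by
      have := hnorm z hz
      rw [h, norm_zero, eq_comm, Real.rpow_eq_zero (norm_nonneg _) (by positivity)] at this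
      simpa using this
    -- Thus `κ⁻¹ * g` plays the role of `f / G`, but is analytic also across the zeros of `f`.
    have hkG : ∀ z ∈ ball (0 : ℂ) 1, κ⁻¹ * g z * G z = f.eval z := fun z hz => by
      rw [mul_assoc, mul_comm (g z), hmul z hz, inv_mul_cancel_left₀ hκ]
    have hGp : ∀ z ∈ ball (0 : ℂ) 1, ‖f.eval z‖ ^ 2 = ‖G z‖ ^ p := fun z hz => by
      rw [hnorm z hz, ← Real.rpow_mul (norm_nonneg _), div_mul_cancel₀ _ hp0.ne', Real.rpow_two]
    have hGint : G ∈ interpolants p c := by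
      refine ⟨memBergman_of_bounded hG.1 _ hGC, fun j => ?_⟩
      have hord := (hf ▸ hG).le_analyticOrderAt_sub_dataFun hc hαβ (Complex.exp_ne_zero _) hG0
      rw [(iteratedDeriv_eq_of_le_analyticOrderAt_sub
        (hG.1.analyticAt (ball_mem_nhds _ one_pos))
        ((differentiable_dataFun c).analyticAt 0)).1 hord j j.2, iteratedDeriv_dataFun]
    -- The kernel has modulus `|G|^(p-1)` and `|G| ≤ C^(2/p)`, whence the bound.
    refine isMinimalInterpolant_iff_of_kernel hp (hf ▸ natDegree_betaPoly_le c _ _) hGint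
      (k := fun z => κ⁻¹ * g z) (hg.1.const_mul _) ((C ^ (2 / p)) ^ (p - 1)) (fun z hz => ?_)
      (fun z hz => ⟨?_, fun h => ?_⟩)
    · rcases eq_or_ne (G z) 0 with h | h
      · rw [hzeroG z hz h, map_zero, zero_mul, norm_zero]
        exact Real.rpow_nonneg ((norm_nonneg _).trans (hGC z hz)) _
      · have hn : ‖G z‖ ≠ 0 := norm_ne_zero_iff.2 h
        have : ‖(starRingEnd ℂ) (f.eval z) * (κ⁻¹ * g z)‖ = ‖G z‖ ^ (p - 1) := by
          refine mul_right_cancel₀ hn ?_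
          rw [← norm_mul, mul_assoc, hkG z hz, norm_mul, RCLike.norm_conj, ← sq, hGp z hz,
            ← Real.rpow_add_one hn, sub_add_cancel]
        rw [this]
        exact Real.rpow_le_rpow (norm_nonneg _) (hGC z hz) (by linarith)
    · rw [mul_assoc, hkG z hz, Complex.conj_mul', ← hGp z hz]
      push_cast
      rfl
    · rw [hzeroG z hz h, map_zero, zero_mul]
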